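/- Let $k$ be an algebraically closed field and let $R=k[x,y,z,w]$ be bigraded by $\deg x=\deg y=(1,0)$ and $\deg z=\deg w=(0,1)$. For $m,n\in\mathbb Z$ let $R_{m,n}$ be the piece of bidegree $(m,n)$ (which is $0$ if $m<0$ or $n<0$). Let $p_0,p_1,p_2\in R_{2,1}$ have no common zero on $\mathbb P^1\times\mathbb P^1$, and let $$\mathrm{Syz}(p)_{m,n}=\{(A_0,A_1,A_2)\in R_{m-2,n-1}^3 : p_0A_0+p_1A_1+p_2A_2=0\}.$$ Write $H^1(m,n)=H^1(\mathbb P^1\times\mathbb P^1,\mathcal O(m,n))$ for sheaf cohomology, and let $$E_2^{0,1}(m,n)=\ker\bigl(d_1:H^1(m-6,n-3)\to H^1(m-4,n-2)^3\bigr),$$ where $d_1$ is induced by the map of sheaves $\mathcal O(m-6,n-3)\to\mathcal O(m-4,n-2)^3$, $s\mapsto(p_2s,-p_1s,p_0s)$. Then for all $m,n\in\mathbb Z$ there is an exact sequence of $k$-vector spaces $$0\to R_{m-6,n-3}\xrightarrow{\ \alpha\ } R_{m-4,n-2}^3\xrightarrow{\ \beta\ }\mathrm{Syz}(p)_{m,n}\to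 E_2^{0,1}(m,n)\to 0,$$ in which $\alpha$ and $\beta$ are the maps of the Koszul complex of $p_0,p_1,p_2$: $$\alpha(f)=(p_2f,\,-p_1f,\,p_0f),\qquad \beta(g_0,g_1,g_2)=(p_1g_0+p_2g_1,\ -p_0g_0+p_2g_2,\ -p_0g_1-p_1g_2).$$ -/

import Mathlib

open CategoryTheory TopologicalSpace Opposite

universe u

namespace BigradedKoszul

noncomputable section

/-! ### The bigraded polynomial ring -/

/-- The polynomial ring `R = k[x, y, z, w]`, where `x, y` are the variables `Sum.inl 0`,
`Sum.inl 1` and `z, w` are the variables `Sum.inr 0`, `Sum.inr 1`. -/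
abbrev Ring4 (k : Type u) [Field k] : Type u := MvPolynomial (Fin 2 ⊕ Fin 2) k

/-- The variables `x, y` have bidegree `(1, 0)`, and `z, w` have bidegree `(0, 1)`. -/
def bidegree : Fin 2 ⊕ Fin 2 → ℤ × ℤ := Sum.elim (fun _ => (1, 0)) (fun _ => (0, 1))

/-- The graded piece `R_{m,n}`, for arbitrary integers `m, n` (it is zero if `m < 0` or
`n < 0`). -/
abbrev Piece (k : Type u) [Field k] (m n : ℤ) : Submodule k (Ring4 k) :=
  MvPolynomial.weightedHomogeneousSubmodule k bidegree (m, n)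

variable {k : Type u} [Field k]

lemma mul_mem_piece {a b c d a' b' : ℤ} {f g : Ring4 k} (hf : f ∈ Piece k a b)
    (hg : g ∈ Piece k c d) (ha : a + c = a') (hb : b + d = b') : f * g ∈ Piece k a' b' := by
  subst ha hb
  exact MvPolynomial.IsWeightedHomogeneous.mul hf hg

/-- Multiplication by an element of `R_{a,b}`, as a linear map `R_{c,d} → R_{a+c,b+d}`. -/
def mulPiece {a b c d a' b' : ℤ} (p : Piece k a b) (ha : a + c = a') (hb : b + d = b') :
    Piece k c d →ₗ[k] Piece k a' b' where
  toFun f := ⟨p.1 * f.1, mul_mem_piece p.2 f.2 ha hb⟩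
  map_add' _ _ := Subtype.ext (mul_add _ _ _)
  map_smul' _ _ := Subtype.ext (mul_smul_comm _ _ _)

/-! ### The Koszul complex of `p₀, p₁, p₂ ∈ R_{2,1}` and the syzygies, in bidegree `(m, n)` -/

/-- The first Koszul map `R_{m-6,n-3} → R_{m-4,n-2}³`, `f ↦ (p₂ f, -p₁ f, p₀ f)`. -/
def koszulThree (p : Fin 3 → Piece k 2 1) (m n : ℤ) :
    Piece k (m - 6) (n - 3) →ₗ[k] (Fin 3 → Piece k (m - 4) (n - 2)) :=
  LinearMap.pi ![mulPiece (p 2) (by ring) (by ring), -mulPiece (p 1) (by ring) (by ring),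
    mulPiece (p 0) (by ring) (by ring)]

/-- The degree `(m, n)` part `Syz(p)_{m,n}` of the syzygy module
`Syz(p) = ker (R(-2,-1)³ → R)`: triples `(A₀, A₁, A₂)` in `R_{m-2,n-1}³` with
`p₀ A₀ + p₁ A₁ + p₂ A₂ = 0`. -/
def Syz (p : Fin 3 → Piece k 2 1) (m n : ℤ) :
    Submodule k (Fin 3 → Piece k (m - 2) (n - 1)) :=
  LinearMap.ker (∑ i, (mulPiece (a' := m) (b' := n) (p i) (by ring) (by ring)) ∘ₗ
    LinearMap.proj (R := k) (φ := fun _ : Fin 3 => Piece k (m - 2) (n - 1)) i)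

lemma mem_syz_iff (p : Fin 3 → Piece k 2 1) (m n : ℤ)
    (A : Fin 3 → Piece k (m - 2) (n - 1)) :
    A ∈ Syz p m n ↔ ∑ i, (p i : Ring4 k) * (A i : Ring4 k) = 0 := by
  rw [Syz, LinearMap.mem_ker, ← Submodule.coe_eq_zero]
  simp [Fin.sum_univ_three, mulPiece]

/-- The second Koszul map, as a map `R_{m-4,n-2}³ → R_{m-2,n-1}³`,
`(g₀, g₁, g₂) ↦ (p₁ g₀ + p₂ g₁, -p₀ g₀ + p₂ g₂, -p₀ g₁ - p₁ g₂)`. -/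
def koszulTwoAux (p : Fin 3 → Piece k 2 1) (m n : ℤ) :
    (Fin 3 → Piece k (m - 4) (n - 2)) →ₗ[k] (Fin 3 → Piece k (m - 2) (n - 1)) :=
  let μ (i : Fin 3) : Piece k (m - 4) (n - 2) →ₗ[k] Piece k (m - 2) (n - 1) :=
    mulPiece (p i) (by ring) (by ring)
  let π (i : Fin 3) : (Fin 3 → Piece k (m - 4) (n - 2)) →ₗ[k] Piece k (m - 4) (n - 2) :=
    LinearMap.proj i
  LinearMap.pi ![μ 1 ∘ₗ π 0 + μ 2 ∘ₗ π 1, -(μ 0 ∘ₗ π 0) + μ 2 ∘ₗ π 2,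
    -(μ 0 ∘ₗ π 1) - μ 1 ∘ₗ π 2]

lemma koszulTwoAux_mem (p : Fin 3 → Piece k 2 1) (m n : ℤ)
    (g : Fin 3 → Piece k (m - 4) (n - 2)) : koszulTwoAux p m n g ∈ Syz p m n := by
  rw [mem_syz_iff]
  simp [Fin.sum_univ_three, koszulTwoAux, mulPiece]
  ring

/-- The second Koszul map, with values in the syzygies: `R_{m-4,n-2}³ → Syz(p)_{m,n}`. -/
def koszulTwo (p : Fin 3 → Piece k 2 1) (m n : ℤ) :
    (Fin 3 → Piece k (m - 4) (n - 2)) →ₗ[k] Syz p m n :=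
  (koszulTwoAux p m n).codRestrict (Syz p m n) (koszulTwoAux_mem p m n)

/-! ### The variety `ℙ¹ × ℙ¹` with its Zariski topology -/

variable (k) in
/-- The set of (closed) points of `ℙ¹ × ℙ¹` over `k`. -/
def BiProj : Type u :=
  Projectivization k (Fin 2 → k) × Projectivization k (Fin 2 → k)

/-- The systems of bihomogeneous coordinates `((a₀, a₁), (b₀, b₁))` of a point of
`ℙ¹ × ℙ¹`. -/
def Coords (P : BiProj k) : Type u :=
  {v : (Fin 2 → k) × (Fin 2 → k) // ∃ (h₁ : v.1 ≠ 0) (h₂ : v.2 ≠ 0),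
    Projectivization.mk k v.1 h₁ = P.1 ∧ Projectivization.mk k v.2 h₂ = P.2}

/-- The value of a polynomial at `x = a₀`, `y = a₁`, `z = b₀`, `w = b₁`. -/
def evalAt (v : (Fin 2 → k) × (Fin 2 → k)) : Ring4 k →+* k :=
  MvPolynomial.eval (Sum.elim v.1 v.2)

/-- The Zariski topology, generated by the non-vanishing loci of bihomogeneous polynomials
(these form a basis, as they are closed under finite intersections). -/
instance : TopologicalSpace (BiProj k) :=
  TopologicalSpace.generateFrom
    {U | ∃ (d e : ℤ) (g : Ring4 k), g ∈ Piece k d e ∧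
      U = {P : BiProj k | ∀ v : Coords P, evalAt v.1 g ≠ 0}}

variable (k) in
/-- `ℙ¹ × ℙ¹` as a topological space. -/
abbrev P1P1 : TopCat.{u} := TopCat.of (BiProj k)

/-! ### The line bundles `𝒪(m, n)` -/

/-- A function that assigns to every point of `U` and every choice of bihomogeneous coordinates
of the point a scalar is a *fraction of degree `(m, n)`* if it is the quotient of a
bihomogeneous polynomial of bidegree `(d + m, e + n)` by one of bidegree `(d, e)` which vanishes
nowhere on `U`. -/
def IsFraction (m n : ℤ) {U : Opens (P1P1 k)} (s : ∀ P : U, Coords P.1 → k) : Prop :=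
  ∃ (d e : ℤ) (f g : Ring4 k), f ∈ Piece k (d + m) (e + n) ∧ g ∈ Piece k d e ∧
    ∀ (P : U) (v : Coords P.1), evalAt v.1 g ≠ 0 ∧ s P v = evalAt v.1 f / evalAt v.1 g

variable (k) in
/-- Being a fraction of degree `(m, n)` is stable under restriction. -/
def fractionPrelocal (m n : ℤ) :
    TopCat.PrelocalPredicate (fun P : P1P1 k => Coords P → k) where
  pred s := IsFraction m n s
  res := by
    rintro U V i s ⟨d, e, f, g, hf, hg, h⟩
    exact ⟨d, e, f, g, hf, hg, fun P v => h ⟨P.1, i.le P.2⟩ v⟩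

variable (k) in
/-- Being locally a fraction of degree `(m, n)`: every point of `U` has an open neighbourhood
in `U` on which the function is a fraction of degree `(m, n)`. -/
def locallyFraction (m n : ℤ) : TopCat.LocalPredicate (fun P : P1P1 k => Coords P → k) :=
  (fractionPrelocal k m n).sheafify

lemma locallyFraction_iff {m n : ℤ} {U : Opens (P1P1 k)} {s : ∀ P : U, Coords P.1 → k} :
    (locallyFraction k m n).pred s ↔ ∀ P : U, ∃ (V : Opens (P1P1 k)) (_ : P.1 ∈ V) (i : V ⟶ U),
      IsFraction m n (fun Q : V => s ⟨Q.1, i.le Q.2⟩) := Iff.rfl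

variable (k) in
/-- The sections of `𝒪(m, n)` over `U`: regular functions of degree `(m, n)` in the
bihomogeneous coordinates. -/
def sectionModule (m n : ℤ) (U : Opens (P1P1 k)) : Submodule k (∀ P : U, Coords P.1 → k) where
  carrier := {s | (locallyFraction k m n).pred s}
  add_mem' := by
    intro s t hs ht P
    obtain ⟨V, hV, i, d, e, f, g, hf, hg, h⟩ := hs P
    obtain ⟨V', hV', i', d', e', f', g', hf', hg', h'⟩ := ht P
    refine ⟨V ⊓ V', ⟨hV, hV'⟩, Opens.infLELeft _ _ ≫ i, d + d', e + e', f * g' + g * f', g * g',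
      add_mem (mul_mem_piece hf hg' (by ring) (by ring))
        (mul_mem_piece hg hf' (by ring) (by ring)),
      mul_mem_piece hg hg' rfl rfl, fun Q v => ?_⟩
    obtain ⟨h0, h1⟩ := h ⟨Q.1, Q.2.1⟩ v
    obtain ⟨h0', h1'⟩ := h' ⟨Q.1, Q.2.2⟩ v
    refine ⟨by rw [map_mul]; exact mul_ne_zero h0 h0', ?_⟩
    rw [map_add, map_mul, map_mul, map_mul, ← div_add_div _ _ h0 h0', ← h1, ← h1']
    rfl
  zero_mem' P := ⟨U, P.2, 𝟙 _, 0, 0, 0, 1, zero_mem _,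
    MvPolynomial.isWeightedHomogeneous_one k _, fun Q v => by simp⟩
  smul_mem' := by
    intro r s hs P
    obtain ⟨V, hV, i, d, e, f, g, hf, hg, h⟩ := hs P
    refine ⟨V, hV, i, d, e, r • f, g, Submodule.smul_mem _ _ hf, hg, fun Q v => ?_⟩
    obtain ⟨h0, h1⟩ := h Q v
    refine ⟨h0, ?_⟩
    rw [MvPolynomial.smul_eq_C_mul, map_mul, mul_div_assoc, ← h1]
    simp [evalAt]

variable (k) in
/-- `𝒪(m, n)` as a presheaf of `k`-vector spaces, with restriction of functions. -/
def lineBundlePresheaf (m n : ℤ) : TopCat.Presheaf (ModuleCat.{u} k) (P1P1 k) where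
  obj U := ModuleCat.of k (sectionModule k m n U.unop)
  map {U V} i := ModuleCat.ofHom
    { toFun := fun s =>
        ⟨fun P => s.1 ⟨P.1, i.unop.le P.2⟩, (locallyFraction k m n).res i.unop s.1 s.2⟩
      map_add' := fun _ _ => rfl
      map_smul' := fun _ _ => rfl }

variable (k) in
lemma lineBundlePresheaf_isSheaf (m n : ℤ) :
    TopCat.Presheaf.IsSheaf (lineBundlePresheaf k m n) :=
  (TopCat.Presheaf.isSheaf_iff_isSheaf_comp (forget (ModuleCat.{u} k)) _).mpr
    (TopCat.Presheaf.isSheaf_of_iso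
      (NatIso.ofComponents (fun _ => Iso.refl _) (fun _ => rfl) :
        (TopCat.subsheafToTypes (locallyFraction k m n)).1 ≅
          lineBundlePresheaf k m n ⋙ forget (ModuleCat.{u} k))
      (TopCat.subsheafToTypes (locallyFraction k m n)).property)

variable (k) in
/-- The category of sheaves of `k`-vector spaces on `ℙ¹ × ℙ¹`. -/
abbrev Sh := Sheaf (Opens.grothendieckTopology (P1P1 k)) (ModuleCat.{u} k)

variable (k) in
/-- The line bundle `𝒪(m, n)` on `ℙ¹ × ℙ¹`, as a sheaf of `k`-vector spaces. -/
def lineBundle (m n : ℤ) : Sh k := ⟨lineBundlePresheaf k m n, lineBundlePresheaf_isSheaf k m n⟩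

lemma mul_mem_sectionModule {a b c d a' b' : ℤ} (p : Piece k a b) (ha : a + c = a')
    (hb : b + d = b') {U : Opens (P1P1 k)} (s : sectionModule k c d U) :
    (fun P v => evalAt v.1 p.1 * s.1 P v) ∈ sectionModule k a' b' U := by
  intro P
  obtain ⟨V, hV, i, d', e', f, g, hf, hg, h⟩ := s.2 P
  refine ⟨V, hV, i, d', e', p.1 * f, g,
    mul_mem_piece p.2 hf (by rw [← ha]; ring) (by rw [← hb]; ring), hg, fun Q v => ?_⟩
  obtain ⟨h0, h1⟩ := h Q v
  refine ⟨h0, ?_⟩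
  rw [map_mul, mul_div_assoc, ← h1]

/-- Multiplication by an element of `R_{a,b}`, as a map of sheaves `𝒪(c,d) → 𝒪(a+c,b+d)`. -/
def mulBundle {a b c d a' b' : ℤ} (p : Piece k a b) (ha : a + c = a') (hb : b + d = b') :
    lineBundle k c d ⟶ lineBundle k a' b' where
  hom :=
    { app := fun U => ModuleCat.ofHom
        { toFun := fun s : sectionModule k c d U.unop =>
            (⟨fun P v => evalAt v.1 p.1 * s.1 P v, mul_mem_sectionModule p ha hb s⟩ :
              sectionModule k a' b' U.unop)
          map_add' := fun s t => Subtype.ext <| by funext P v; exact mul_add _ _ _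
          map_smul' := fun r s => Subtype.ext <| by funext P v; exact mul_left_comm _ _ _ }
      naturality := fun _ _ _ => rfl }

/-! ### Sheaf cohomology -/

variable (k) in
/-- Sheaf cohomology `H^q(ℙ¹ × ℙ¹, F)` of a sheaf of `k`-vector spaces: the derived functors of
`F ↦ Γ(ℙ¹ × ℙ¹, F) = Hom(k, F)`, where `k` is the constant sheaf, as a `k`-vector space. -/
abbrev Cohomology (F : Sh k) (q : ℕ) : Type u :=
  Abelian.Ext ((constantSheaf (Opens.grothendieckTopology (P1P1 k)) (ModuleCat.{u} k)).obj
    (ModuleCat.of k k)) F q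

/-- The map induced on cohomology by a map of sheaves. -/
def cohomologyMap {F G : Sh k} (φ : F ⟶ G) (q : ℕ) : Cohomology k F q →ₗ[k] Cohomology k G q :=
  Abelian.Ext.postcompOfLinear (Abelian.Ext.mk₀ φ) k _ (add_zero q)

variable (k) in
/-- `H^q(m, n) = H^q(ℙ¹ × ℙ¹, 𝒪(m, n))`. -/
abbrev H (q : ℕ) (m n : ℤ) : Type u := Cohomology k (lineBundle k m n) q

/-- The map `d₁ : H¹(m-6, n-3) → H¹(m-4, n-2)³` induced by the Koszul map
`𝒪(m-6, n-3) → 𝒪(m-4, n-2)³`, `s ↦ (p₂ s, -p₁ s, p₀ s)`. -/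
def d₁ (p : Fin 3 → Piece k 2 1) (m n : ℤ) :
    H k 1 (m - 6) (n - 3) →ₗ[k] (Fin 3 → H k 1 (m - 4) (n - 2)) :=
  LinearMap.pi ![cohomologyMap (mulBundle (p 2) (by ring) (by ring)) 1,
    cohomologyMap (-mulBundle (p 1) (by ring) (by ring)) 1,
    cohomologyMap (mulBundle (p 0) (by ring) (by ring)) 1]

/-- The term `E₂^{0,1}(m, n) = ker (d₁ : H¹(m-6, n-3) → H¹(m-4, n-2)³)`. -/
abbrev E₂ (p : Fin 3 → Piece k 2 1) (m n : ℤ) : Submodule k (H k 1 (m - 6) (n - 3)) :=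
  LinearMap.ker (d₁ p m n)

end

end BigradedKoszul

/-!
The four-term sequence is the beginning of the long exact cohomology sequence of the sheaf version
of the Koszul complex,
`0 → 𝒪(m-6, n-3) → 𝒪(m-4, n-2)³ → 𝒪(m-2, n-1)³ → 𝒪(m, n)`.

Since `p₀, p₁, p₂` have no common zero, some `p i` is invertible near every point, and dividing by
it contracts the Koszul complex; so the complex of sheaves is exact
(`mono_sheafKoszulThree`, `exact_sheafKoszulThree_sheafKoszulTwo`,
`exact_sheafKoszulTwo_sheafKoszulOne`). Let `K` be the kernel of the last map. The long exact
sequence of `0 → 𝒪(m-6, n-3) → 𝒪(m-4, n-2)³ → K → 0` reads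
`0 → Γ(𝒪(m-6, n-3)) → Γ(𝒪(m-4, n-2))³ → Γ(K) → H¹(m-6, n-3) → H¹(m-4, n-2)³`,
so that `Γ(K)` modulo the image of the second map is the kernel `E₂` of `d₁`
(`exists_connecting`, `mem_E₂_iff`). No cohomology group has to be computed.

What remains is to identify `Γ(𝒪(m, n))` with `R_{m,n}` for all integers `m, n`, which gives
`Γ(K) = Syz(p)_{m,n}` by left exactness (`kerEquivSyz`). As `ℙ¹ × ℙ¹` is irreducible, the local
expressions of a global section as a fraction all agree in the fraction field of the factorial
ring `R`. The denominator of this fraction in lowest terms divides all the local denominators, so it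
has no zeros with `(x, y) ≠ 0` and `(z, w) ≠ 0`. Over an algebraically closed field such a
polynomial is constant, because it is constant along each line that avoids the excluded points
(`exists_eq_C_of_evalAt_ne_zero`, `globalSection_surjective`).
-/

namespace BigradedKoszul

noncomputable section

variable {k : Type u} [Field k]

/-! ### Bihomogeneous polynomials as functions of the coordinates -/

/-- A bihomogeneous polynomial scales by the character of its bidegree. The scalars are nonzero
since the bidegree is a pair of integers. -/
lemma eval_scale {d e : ℤ} {f : Ring4 k} (hf : f ∈ Piece k d e) {r s : k} (hr : r ≠ 0)
    (hs : s ≠ 0) (a b : Fin 2 → k) :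
    evalAt (r • a, s • b) f = r ^ d * s ^ e * evalAt (a, b) f := by
  have key : ∀ c ∈ f.support, (∏ i, Sum.elim (r • a) (s • b) i ^ c i) =
      r ^ d * s ^ e * ∏ i, Sum.elim a b i ^ c i := by
    intro c hc
    have hw := hf (MvPolynomial.mem_support_iff.mp hc)
    have h1 : (c (Sum.inl 0) : ℤ) + c (Sum.inl 1) = d := by
      have := congrArg Prod.fst hw
      simpa [Finsupp.weight_apply, Finsupp.sum_fintype, bidegree] using this
    have h2 : (c (Sum.inr 0) : ℤ) + c (Sum.inr 1) = e := by
      have := congrArg Prod.snd hw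
      simpa [Finsupp.weight_apply, Finsupp.sum_fintype, bidegree] using this
    rw [← h1, ← h2, zpow_add₀ hr, zpow_add₀ hs]
    simp [mul_pow]
    ring
  simp only [evalAt, MvPolynomial.eval_eq', Finset.mul_sum]
  refine Finset.sum_congr rfl fun c hc => ?_
  rw [key c hc]
  ring

/-- The point of `ℙ¹ × ℙ¹` with given bihomogeneous coordinates. -/
def point (a b : Fin 2 → k) (ha : a ≠ 0) (hb : b ≠ 0) : BiProj k :=
  (Projectivization.mk k a ha, Projectivization.mk k b hb)

/-- The given coordinates of `point a b`. -/
def pointCoords (a b : Fin 2 → k) (ha : a ≠ 0) (hb : b ≠ 0) : Coords (point a b ha hb) :=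
  ⟨(a, b), ha, hb, rfl, rfl⟩

lemma exists_coords (P : BiProj k) : Nonempty (Coords P) := by
  obtain ⟨P₁, P₂⟩ := P
  induction P₁ using Projectivization.ind with
  | h a ha =>
    induction P₂ using Projectivization.ind with
    | h b hb => exact ⟨⟨(a, b), ha, hb, rfl, rfl⟩⟩

lemma evalAt_ne_zero {d e : ℤ} {f : Ring4 k} (hf : f ∈ Piece k d e) {P : BiProj k}
    {v : Coords P} (hv : evalAt v.1 f ≠ 0) (w : Coords P) : evalAt w.1 f ≠ 0 := by
  obtain ⟨⟨a, b⟩, ha, hb, h1, h2⟩ := v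
  obtain ⟨⟨a', b'⟩, ha', hb', h1', h2'⟩ := w
  obtain ⟨r, hr⟩ := (Projectivization.mk_eq_mk_iff k _ _ ha' ha).mp (h1'.trans h1.symm)
  obtain ⟨s, hs⟩ := (Projectivization.mk_eq_mk_iff k _ _ hb' hb).mp (h2'.trans h2.symm)
  simp only at hr hs hv ⊢
  rw [← hr, ← hs]
  have := eval_scale hf r.ne_zero s.ne_zero a b
  rw [Units.smul_def, Units.smul_def, this]
  exact mul_ne_zero (mul_ne_zero (zpow_ne_zero _ r.ne_zero) (zpow_ne_zero _ s.ne_zero)) hv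

/-- The open set where a bihomogeneous polynomial does not vanish. -/
def basicOpen {d e : ℤ} (g : Piece k d e) : Opens (P1P1 k) where
  carrier := {P : BiProj k | ∀ v : Coords P, evalAt v.1 g.1 ≠ 0}
  is_open' := TopologicalSpace.isOpen_generateFrom_of_mem ⟨d, e, g.1, g.2, rfl⟩

lemma exists_basicOpen_le {U : Set (BiProj k)} (hU : IsOpen U) {P : BiProj k} (hP : P ∈ U) :
    ∃ (d e : ℤ) (g : Piece k d e), P ∈ basicOpen g ∧ ∀ Q ∈ basicOpen g, Q ∈ U := by
  induction hU with
  | basic s hs =>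
    obtain ⟨d, e, g, hg, rfl⟩ := hs
    exact ⟨d, e, ⟨g, hg⟩, hP, fun _ h => h⟩
  | univ =>
    exact ⟨0, 0, ⟨1, MvPolynomial.isWeightedHomogeneous_one k _⟩,
      fun v => by simp, fun _ _ => trivial⟩
  | inter s t _ _ hs ht =>
    obtain ⟨d, e, g, h1, h2⟩ := hs hP.1
    obtain ⟨d', e', g', h1', h2'⟩ := ht hP.2
    refine ⟨d + d', e + e', ⟨g.1 * g'.1, mul_mem_piece g.2 g'.2 rfl rfl⟩, fun v => ?_,
      fun Q hQ => ⟨h2 Q fun v => ?_, h2' Q fun v => ?_⟩⟩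
    · rw [map_mul]; exact mul_ne_zero (h1 v) (h1' v)
    · have := hQ v
      rw [map_mul] at this; exact left_ne_zero_of_mul this
    · have := hQ v
      rw [map_mul] at this; exact right_ne_zero_of_mul this
  | sUnion S _ ih =>
    obtain ⟨s, hs, hPs⟩ := hP
    obtain ⟨d, e, g, h1, h2⟩ := ih s hs hPs
    exact ⟨d, e, g, h1, fun Q hQ => ⟨s, hs, h2 Q hQ⟩⟩

/-- A polynomial is determined by its values at the pairs of nonzero vectors: multiply by `xz`. -/
lemma eq_zero_of_evalAt [Infinite k] {f : Ring4 k}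
    (h : ∀ a b : Fin 2 → k, a ≠ 0 → b ≠ 0 → evalAt (a, b) f = 0) : f = 0 := by
  have h0 : MvPolynomial.X (Sum.inl 0) * MvPolynomial.X (Sum.inr 0) * f = 0 := by
    refine MvPolynomial.funext fun v => ?_
    by_cases h1 : v (Sum.inl 0) = 0
    · simp [h1]
    by_cases h2 : v (Sum.inr 0) = 0
    · simp [h2]
    have := h (v ∘ Sum.inl) (v ∘ Sum.inr) (fun h => h1 (congrFun h 0)) (fun h => h2 (congrFun h 0))
    simp only [evalAt, Sum.elim_comp_inl_inr] at this
    simp [this]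
  exact (mul_eq_zero.mp h0).resolve_left
    (mul_ne_zero (MvPolynomial.X_ne_zero _) (MvPolynomial.X_ne_zero _))

/-- The nonempty open subset `D(h)` is dense: a polynomial vanishing at all the coordinates where
`h ≠ 0` does not vanish is zero. -/
lemma eq_zero_of_evalAt_of_ne [Infinite k] {f h : Ring4 k} (hh : h ≠ 0)
    (H : ∀ a b : Fin 2 → k, a ≠ 0 → b ≠ 0 → evalAt (a, b) h ≠ 0 → evalAt (a, b) f = 0) :
    f = 0 := by
  refine (mul_eq_zero.mp (eq_zero_of_evalAt (f := h * f) fun a b ha hb => ?_)).resolve_left hh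
  rw [map_mul]
  by_cases h0 : evalAt (a, b) h = 0
  · rw [h0, zero_mul]
  · rw [H a b ha hb h0, mul_zero]

/-! ### Polynomials without zeros on `ℙ¹ × ℙ¹` -/

/-- A polynomial function without zeros along a line is constant on the line. -/
lemma evalAt_eq_of_line [IsAlgClosed k] {g : Ring4 k} {v w : (Fin 2 → k) × (Fin 2 → k)}
    (h : ∀ t : k, evalAt (v + t • (w - v)) g ≠ 0) : evalAt v g = evalAt w g := by
  let q : Polynomial k := MvPolynomial.aeval (fun i : Fin 2 ⊕ Fin 2 =>
    Polynomial.C (Sum.elim v.1 v.2 i) +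
      Polynomial.X * Polynomial.C (Sum.elim w.1 w.2 i - Sum.elim v.1 v.2 i)) g
  have hq : ∀ t, q.eval t = evalAt (v + t • (w - v)) g := by
    intro t
    have : (Polynomial.evalRingHom t).comp
        (MvPolynomial.aeval (R := k) (fun i : Fin 2 ⊕ Fin 2 =>
          Polynomial.C (Sum.elim v.1 v.2 i) +
      Polynomial.X * Polynomial.C (Sum.elim w.1 w.2 i - Sum.elim v.1 v.2 i))).toRingHom =
      evalAt (v + t • (w - v)) := by
      refine MvPolynomial.ringHom_ext (fun r => by simp [evalAt]) fun i => ?_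
      rcases i with i | i <;> simp [evalAt]
    exact congrArg (fun φ : Ring4 k →+* k => φ g) this
  have hdeg : q.degree = 0 := by
    by_contra hd
    obtain ⟨t, ht⟩ := IsAlgClosed.exists_root q hd
    exact h t ((hq t).symm.trans ht)
  have h0 := hq 0
  have h1 := hq 1
  rw [Polynomial.eq_C_of_degree_eq_zero hdeg, Polynomial.eval_C] at h0 h1
  have := h0.symm.trans h1
  simpa using this

/-- Nonzero vectors `a, a'` of `k²` are joined by at most two lines avoiding the origin. -/
lemma exists_lines_avoiding_zero {a a' : Fin 2 → k} (ha : a ≠ 0) (ha' : a' ≠ 0) :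
    ∃ c : Fin 2 → k, (∀ t : k, a + t • (c - a) ≠ 0) ∧ ∀ t : k, c + t • (a' - c) ≠ 0 := by
  -- if the determinant of `a, c` is nonzero, then the line through `a` and `c` avoids the origin
  have key : ∀ b c : Fin 2 → k, b 0 * c 1 - b 1 * c 0 ≠ 0 → ∀ t : k, b + t • (c - b) ≠ 0 := by
    intro b c h t h0
    have e0 := congrFun h0 0
    have e1 := congrFun h0 1
    simp only [Pi.add_apply, Pi.smul_apply, Pi.sub_apply, smul_eq_mul, Pi.zero_apply] at e0 e1
    have ht : t * (b 0 * c 1 - b 1 * c 0) = 0 := by linear_combination b 0 * e1 - b 1 * e0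
    have ht0 := (mul_eq_zero.mp ht).resolve_right h
    rw [ht0] at e0 e1
    apply h
    linear_combination c 1 * e0 - c 0 * e1
  suffices H : ∃ c : Fin 2 → k, a 0 * c 1 - a 1 * c 0 ≠ 0 ∧ c 0 * a' 1 - c 1 * a' 0 ≠ 0 by
    obtain ⟨c, h1, h2⟩ := H
    exact ⟨c, key _ _ h1, key _ _ h2⟩
  -- a linear form nonzero on `a`, and one nonzero on `a'`: some `c` works for both
  have ex : ∀ b : Fin 2 → k, b ≠ 0 → ∃ c : Fin 2 → k, b 0 * c 1 - b 1 * c 0 ≠ 0 := by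
    intro b hb
    by_cases h : b 0 = 0
    · refine ⟨![1, 0], fun h' => hb ?_⟩
      have : b 1 = 0 := by simpa [h] using h'
      ext i; fin_cases i <;> assumption
    · exact ⟨![0, 1], by simpa using h⟩
  obtain ⟨c, hc⟩ := ex a ha
  obtain ⟨c', hc'⟩ := ex a' ha'
  by_cases h1 : c 0 * a' 1 - c 1 * a' 0 = 0
  · by_cases h2 : a 0 * c' 1 - a 1 * c' 0 = 0
    · refine ⟨c + c', ?_, ?_⟩ <;> simp only [Pi.add_apply]
      · intro h; apply hc; linear_combination h - h2
      · intro h; apply hc'; linear_combination h1 - h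
    · exact ⟨c', h2, fun h => hc' (by linear_combination -h)⟩
  · exact ⟨c, hc, h1⟩

/-- A regular nowhere vanishing function on `(k² ∖ 0) × (k² ∖ 0)` that comes from a polynomial is
constant. -/
lemma exists_eq_C_of_evalAt_ne_zero [IsAlgClosed k] {g : Ring4 k}
    (h : ∀ a b : Fin 2 → k, a ≠ 0 → b ≠ 0 → evalAt (a, b) g ≠ 0) :
    ∃ c : k, c ≠ 0 ∧ g = MvPolynomial.C c := by
  have hl : ∀ a a' b : Fin 2 → k, a ≠ 0 → a' ≠ 0 → b ≠ 0 →
      evalAt (a, b) g = evalAt (a', b) g := by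
    intro a a' b ha ha' hb
    obtain ⟨c, h1, h2⟩ := exists_lines_avoiding_zero ha ha'
    refine (evalAt_eq_of_line (w := (c, b)) fun t => ?_).trans (evalAt_eq_of_line fun t => ?_)
    · simpa using h _ _ (h1 t) hb
    · simpa using h _ _ (h2 t) hb
  have hr : ∀ a b b' : Fin 2 → k, a ≠ 0 → b ≠ 0 → b' ≠ 0 →
      evalAt (a, b) g = evalAt (a, b') g := by
    intro a b b' ha hb hb'
    obtain ⟨c, h1, h2⟩ := exists_lines_avoiding_zero hb hb'
    refine (evalAt_eq_of_line (w := (a, c)) fun t => ?_).trans (evalAt_eq_of_line fun t => ?_)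
    · simpa using h _ _ ha (h1 t)
    · simpa using h _ _ ha (h2 t)
  have h1 : (1 : Fin 2 → k) ≠ 0 := one_ne_zero
  have : Infinite k := IsAlgClosed.instInfinite
  refine ⟨evalAt (1, 1) g, h 1 1 h1 h1, ?_⟩
  rw [← sub_eq_zero]
  refine eq_zero_of_evalAt fun a b ha hb => ?_
  rw [map_sub, hl a 1 b ha h1 hb, hr 1 b 1 h1 hb h1]
  simp [evalAt]

/-! ### Global sections of `𝒪(m, n)` -/

/-- If `g ∈ R_{d,e}` is nonzero and `g * F ∈ R_{d+m,e+n}`, then `F ∈ R_{m,n}`. -/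
lemma mem_piece_of_mul_mem {d e m n : ℤ} {g F : Ring4 k} (hg : g ∈ Piece k d e) (hg0 : g ≠ 0)
    (h : g * F ∈ Piece k (d + m) (e + n)) : F ∈ Piece k m n := by
  classical
  let := MvPolynomial.weightedGradedAlgebra k bidegree
  have h1 := DirectSum.coe_decompose_mul_add_of_left_mem
    (MvPolynomial.weightedHomogeneousSubmodule k bidegree) (i := (d, e)) (j := (m, n))
    (b := F) hg
  have h2 := DirectSum.decompose_of_mem_same
    (MvPolynomial.weightedHomogeneousSubmodule k bidegree) (i := (d, e) + (m, n)) h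
  rw [h2] at h1
  rw [mul_left_cancel₀ hg0 h1]
  exact SetLike.coe_mem _

/-- A polynomial of bidegree `(m, n)`, as a global section of `𝒪(m, n)`. -/
def globalSection (m n : ℤ) : Piece k m n →ₗ[k] sectionModule k m n (⊤ : Opens (P1P1 k)) where
  toFun f := ⟨fun P v => evalAt v.1 f.1, fun P => ⟨⊤, trivial, 𝟙 _, 0, 0, f.1, 1,
    by simp, MvPolynomial.isWeightedHomogeneous_one k _, fun Q v => by simp⟩⟩
  map_add' f g := Subtype.ext <| by funext P v; exact map_add _ _ _
  map_smul' r f := Subtype.ext <| by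
    funext P v
    simp [MvPolynomial.smul_eq_C_mul, evalAt]

lemma globalSection_injective [Infinite k] (m n : ℤ) :
    Function.Injective (globalSection (k := k) m n) := by
  rw [injective_iff_map_eq_zero]
  intro f hf
  refine Subtype.ext (eq_zero_of_evalAt fun a b ha hb => ?_)
  exact congrFun (congrFun (congrArg Subtype.val hf) ⟨point a b ha hb, trivial⟩)
    (pointCoords a b ha hb)

/-- Two expressions `f / g = f' / g'` of a section as a fraction, on neighbourhoods of two points,
agree as fractions of polynomials, since any two nonempty open sets meet. -/
lemma fraction_mul_eq [Infinite k] {d e d' e' : ℤ} {f g f' g' : Ring4 k} {h : Piece k d e}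
    {h' : Piece k d' e'} (h0 : h.1 ≠ 0) (h0' : h'.1 ≠ 0)
    {s : ∀ P : BiProj k, Coords P → k}
    (H : ∀ P ∈ basicOpen h, ∀ v : Coords P, evalAt v.1 g ≠ 0 ∧
      s P v = evalAt v.1 f / evalAt v.1 g)
    (H' : ∀ P ∈ basicOpen h', ∀ v : Coords P, evalAt v.1 g' ≠ 0 ∧
      s P v = evalAt v.1 f' / evalAt v.1 g') : f * g' = f' * g := by
  rw [← sub_eq_zero]
  refine eq_zero_of_evalAt_of_ne (mul_ne_zero h0 h0') fun a b ha hb hab => ?_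
  rw [map_mul] at hab
  obtain ⟨h1, h2⟩ := H (point a b ha hb)
    (evalAt_ne_zero h.2 (v := pointCoords a b ha hb) (left_ne_zero_of_mul hab))
    (pointCoords a b ha hb)
  obtain ⟨h1', h2'⟩ := H' (point a b ha hb)
    (evalAt_ne_zero h'.2 (v := pointCoords a b ha hb) (right_ne_zero_of_mul hab))
    (pointCoords a b ha hb)
  rw [h2, div_eq_div_iff h1 h1'] at h2'
  rw [map_sub, map_mul, map_mul]
  exact sub_eq_zero.mpr h2'

lemma globalSection_surjective [IsAlgClosed k] (m n : ℤ) :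
    Function.Surjective (globalSection (k := k) m n) := by
  have : Infinite k := IsAlgClosed.instInfinite
  intro s
  let s' : ∀ P : BiProj k, Coords P → k := fun P => s.1 ⟨P, trivial⟩
  have loc : ∀ P : BiProj k, ∃ (d e d' e' : ℤ) (f g : Ring4 k) (h : Piece k d' e'),
      f ∈ Piece k (d + m) (e + n) ∧ g ∈ Piece k d e ∧ P ∈ basicOpen h ∧
      ∀ Q ∈ basicOpen h, ∀ v : Coords Q, evalAt v.1 g ≠ 0 ∧
        s' Q v = evalAt v.1 f / evalAt v.1 g := by
    intro P
    obtain ⟨V, hV, i, d, e, f, g, hf, hg, H⟩ := s.2 ⟨P, trivial⟩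
    obtain ⟨d', e', h, hP, hh⟩ := exists_basicOpen_le V.2 hV
    exact ⟨d, e, d', e', f, g, h, hf, hg, hP, fun Q hQ v => H ⟨Q, hh Q hQ⟩ v⟩
  choose d e d' e' f g h hf hg hP H using loc
  have hh0 : ∀ P, (h P).1 ≠ 0 := by
    intro P h0
    obtain ⟨v⟩ := exists_coords P
    exact hP P v (by rw [h0, map_zero])
  have hg0 : ∀ P, g P ≠ 0 := by
    intro P h0
    obtain ⟨v⟩ := exists_coords P
    exact (H P P (hP P) v).1 (by rw [h0, map_zero])
  have hfg : ∀ P Q, f P * g Q = f Q * g P := fun P Q =>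
    fraction_mul_eq (hh0 P) (hh0 Q) (H P) (H Q)
  -- the common value of the fractions `f P / g P`, in lowest terms
  let P₀ : BiProj k := point 1 1 one_ne_zero one_ne_zero
  obtain ⟨f₀, g₀, c, hrel, hcf, hcg⟩ :=
    UniqueFactorizationMonoid.exists_reduced_factors' (f P₀) (g P₀) (hg0 P₀)
  have hc : c ≠ 0 := fun h0 => hg0 P₀ (by rw [← hcg, h0, zero_mul])
  have hred : ∀ P, f P * g₀ = f₀ * g P := by
    intro P
    have := hfg P P₀
    rw [← hcf, ← hcg] at this
    exact mul_left_cancel₀ hc (by linear_combination this)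
  -- the denominator `g₀` divides every `g P`, so it has no zeros and is constant
  have hdvd : ∀ P, g₀ ∣ g P := fun P =>
    hrel.symm.dvd_of_dvd_mul_left (Dvd.intro_left _ (hred P))
  obtain ⟨r, hr, hg₀⟩ := exists_eq_C_of_evalAt_ne_zero (g := g₀) fun a b ha hb h0 => by
    obtain ⟨q, hq⟩ := hdvd (point a b ha hb)
    refine (H _ _ (hP (point a b ha hb)) (pointCoords a b ha hb)).1 ?_
    change evalAt (a, b) _ = 0
    rw [hq, map_mul, h0, zero_mul]
  let F : Ring4 k := MvPolynomial.C r⁻¹ * f₀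
  have hF : ∀ P, f P = g P * F := by
    intro P
    have h1 : (MvPolynomial.C r⁻¹ : Ring4 k) * MvPolynomial.C r = 1 := by
      rw [← map_mul, inv_mul_cancel₀ hr, map_one]
    have := hred P
    rw [hg₀] at this
    linear_combination MvPolynomial.C r⁻¹ * this - f P * h1
  have hFm : F ∈ Piece k m n :=
    mem_piece_of_mul_mem (hg P₀) (hg0 P₀) (by rw [← hF]; exact hf P₀)
  refine ⟨⟨F, hFm⟩, Subtype.ext ?_⟩
  funext P v
  obtain ⟨h1, h2⟩ := H P.1 P.1 (hP P.1) v
  refine Eq.trans ?_ h2.symm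
  rw [hF, map_mul, mul_div_cancel_left₀ _ h1]
  rfl

/-! ### Sections of sheaves of vector spaces, and exactness -/

/-- The sections of a sheaf over an open set. -/
abbrev sections (F : Sh k) (U : Opens (P1P1 k)) : ModuleCat.{u} k := F.obj.obj (op U)

/-- The map on sections over `U` induced by a map of sheaves. -/
abbrev sectionsMap {F G : Sh k} (φ : F ⟶ G) (U : Opens (P1P1 k)) :
    sections F U →ₗ[k] sections G U := (φ.hom.app (op U)).hom

/-- Restriction of sections. -/
abbrev restrict (F : Sh k) {U V : Opens (P1P1 k)} (i : V ⟶ U) :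
    sections F U →ₗ[k] sections F V := (F.obj.map i.op).hom

lemma sectionsMap_restrict {F G : Sh k} (φ : F ⟶ G) {U V : Opens (P1P1 k)} (i : V ⟶ U)
    (s : sections F U) : sectionsMap φ V (restrict F i s) = restrict G i (sectionsMap φ U s) :=
  ConcreteCategory.congr_hom (φ.hom.naturality i.op) s

lemma sectionsMap_comp {F G H : Sh k} (φ : F ⟶ G) (ψ : G ⟶ H) (U : Opens (P1P1 k))
    (s : sections F U) : sectionsMap (φ ≫ ψ) U s = sectionsMap ψ U (sectionsMap φ U s) := rfl

lemma sectionsMap_id {F : Sh k} (U : Opens (P1P1 k))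
    (s : sections F U) : sectionsMap (𝟙 F) U s = s := rfl

lemma sectionsMap_zero {F G : Sh k} (U : Opens (P1P1 k))
    (s : sections F U) : sectionsMap (0 : F ⟶ G) U s = 0 := rfl

lemma sectionsMap_injective {F G : Sh k} (φ : F ⟶ G) [Mono φ] (U : Opens (P1P1 k)) :
    Function.Injective (sectionsMap φ U) := by
  have : Mono φ.hom := inferInstanceAs (Mono ((sheafToPresheaf _ _).map φ))
  exact (ModuleCat.mono_iff_injective _).mp
    (inferInstanceAs (Mono (((evaluation _ _).obj (op U)).map φ.hom)))

lemma mono_of_sectionsMap_injective {F G : Sh k} (φ : F ⟶ G)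
    (h : ∀ U, Function.Injective (sectionsMap φ U)) : Mono φ := by
  refine (sheafToPresheaf _ _).mono_of_mono_map ?_
  have : ∀ U, Mono (((sheafToPresheaf _ _).map φ).app U) := fun U =>
    (ModuleCat.mono_iff_injective _).mpr (h U.unop)
  exact NatTrans.mono_of_mono_app _

/-- A complex of sheaves is exact if every section killed by the second map locally comes from a
section of the first sheaf. -/
lemma exact_of_locally_exact (S : ShortComplex (Sh k))
    (h : ∀ (U : Opens (P1P1 k)) (s : sections S.X₂ U), sectionsMap S.g U s = 0 → ∀ P ∈ U,
      ∃ (V : Opens (P1P1 k)) (i : V ⟶ U), P ∈ V ∧ ∃ t : sections S.X₁ V,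
        sectionsMap S.f V t = restrict S.X₂ i s) : S.Exact := by
  rw [S.exact_iff_epi_kernel_lift, ← Sheaf.isLocallySurjective_iff_epi']
  refine ⟨fun {U} s P hP => ?_⟩
  obtain ⟨V, i, hPV, t, ht⟩ := h U (sectionsMap (Limits.kernel.ι S.g) U s) (by
    rw [← sectionsMap_comp, Limits.kernel.condition, sectionsMap_zero]) P hP
  refine ⟨V, i, ⟨t, sectionsMap_injective (Limits.kernel.ι S.g) V ?_⟩, hPV⟩
  refine Eq.trans ?_ (ht.trans (sectionsMap_restrict _ i s).symm)
  refine (sectionsMap_comp _ _ _ _).symm.trans ?_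
  rw [Limits.kernel.lift_ι]

/-! ### Maps from the constant sheaf -/

variable (k) in
/-- The constant sheaf `k`. -/
abbrev constSheaf : Sh k :=
  (constantSheaf (Opens.grothendieckTopology (P1P1 k)) (ModuleCat.{u} k)).obj (ModuleCat.of k k)

variable (k) in
/-- The constant sheaf functor is left adjoint to taking global sections. -/
abbrev constAdj := constantSheafAdj (Opens.grothendieckTopology (P1P1 k)) (ModuleCat.{u} k)
  (T := (⊤ : Opens (P1P1 k))) (Limits.isTerminalTop)

variable (k) in
/-- The global section `1` of the constant sheaf. -/
def unitSection : sections (constSheaf k) ⊤ :=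
  ((constAdj k).unit.app (ModuleCat.of k k)).hom (1 : k)

/-- `Hom(k, F) = Γ(ℙ¹ × ℙ¹, F)`. -/
def homEquivSections (F : Sh k) : (constSheaf k ⟶ F) ≃ₗ[k] sections F ⊤ :=
  LinearEquiv.ofBijective
    { toFun := fun φ => sectionsMap φ ⊤ (unitSection k)
      map_add' := fun _ _ => rfl
      map_smul' := fun _ _ => rfl } <| by
    have : (fun φ : constSheaf k ⟶ F => sectionsMap φ ⊤ (unitSection k)) =
        (fun g : ModuleCat.of k k ⟶ sections F ⊤ => g.hom (1 : k)) ∘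
          (constAdj k).homEquiv (ModuleCat.of k k) F := by
      funext φ
      rw [Function.comp_apply, Adjunction.homEquiv_unit]
      rfl
    change Function.Bijective (fun φ : constSheaf k ⟶ F => sectionsMap φ ⊤ (unitSection k))
    rw [this]
    refine Function.Bijective.comp ⟨fun g g' h => ?_, fun s => ?_⟩ (Equiv.bijective _)
    · exact ModuleCat.hom_ext (LinearMap.ext_ring h)
    · exact ⟨ModuleCat.ofHom (LinearMap.toSpanSingleton k _ s), one_smul _ _⟩

lemma homEquivSections_comp {F G : Sh k} (φ : constSheaf k ⟶ F) (ψ : F ⟶ G) :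
    homEquivSections G (φ ≫ ψ) = sectionsMap ψ ⊤ (homEquivSections F φ) := rfl

/-- `R_{m,n} = Γ(ℙ¹ × ℙ¹, 𝒪(m, n))`. -/
def pieceEquivSections [IsAlgClosed k] (m n : ℤ) :
    Piece k m n ≃ₗ[k] sections (lineBundle k m n) ⊤ :=
  LinearEquiv.ofBijective
    (show Piece k m n →ₗ[k] sections (lineBundle k m n) ⊤ from globalSection m n)
    ⟨@globalSection_injective k _ IsAlgClosed.instInfinite m n, globalSection_surjective m n⟩

lemma pieceEquivSections_mul [IsAlgClosed k] {a b c d a' b' : ℤ} (p : Piece k a b)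
    (ha : a + c = a') (hb : b + d = b') (f : Piece k c d) :
    pieceEquivSections a' b' (mulPiece p ha hb f) =
      sectionsMap (mulBundle p ha hb) ⊤ (pieceEquivSections c d f) := by
  refine Subtype.ext ?_
  funext P v
  exact map_mul _ _ _

/-- `Hom(k, 𝒪(m, n)) = R_{m,n}`. -/
def homEquivPiece [IsAlgClosed k] (m n : ℤ) :
    (constSheaf k ⟶ lineBundle k m n) ≃ₗ[k] Piece k m n :=
  (homEquivSections (lineBundle k m n)).trans (pieceEquivSections m n).symm

lemma homEquivPiece_mul [IsAlgClosed k] {a b c d a' b' : ℤ} (p : Piece k a b) (ha : a + c = a')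
    (hb : b + d = b') (φ : constSheaf k ⟶ lineBundle k c d) :
    homEquivPiece a' b' (φ ≫ mulBundle p ha hb) = mulPiece p ha hb (homEquivPiece c d φ) := by
  refine (LinearEquiv.symm_apply_eq _).mpr ?_
  rw [pieceEquivSections_mul]
  refine (homEquivSections_comp φ _).trans ?_
  exact congrArg _ ((pieceEquivSections c d).apply_symm_apply _).symm

/-! ### Division by a nowhere vanishing polynomial -/

/-- The quotient of a section of `𝒪(a+c, b+d)` by a polynomial of bidegree `(a, b)` without zeros
on `V`. -/
lemma exists_mulBundle_eq {a b c d a' b' : ℤ} (p : Piece k a b) (ha : a + c = a')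
    (hb : b + d = b') {V : Opens (P1P1 k)} (hV : V ≤ basicOpen p)
    (s : sections (lineBundle k a' b') V) :
    ∃ t : sections (lineBundle k c d) V, sectionsMap (mulBundle p ha hb) V t = s := by
  refine ⟨⟨fun P v => s.1 P v / evalAt v.1 p.1, fun P => ?_⟩, Subtype.ext ?_⟩
  · obtain ⟨W, hW, i, d', e', f, g, hf, hg, h⟩ := s.2 P
    refine ⟨W, hW, i, d' + a, e' + b, f, g * p.1, ?_, mul_mem_piece hg p.2 rfl rfl,
      fun Q v => ?_⟩
    · rw [← ha, ← hb] at hf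
      rwa [add_assoc, add_assoc]
    · obtain ⟨h0, h1⟩ := h Q v
      refine ⟨by rw [map_mul]; exact mul_ne_zero h0 (hV (i.le Q.2) v), ?_⟩
      rw [map_mul, ← div_div, ← h1]
  · funext P v
    exact mul_div_cancel₀ _ (hV P.2 v)

lemma exists_mem_basicOpen {p : Fin 3 → Piece k 2 1}
    (hp : ∀ a b : Fin 2 → k, a ≠ 0 → b ≠ 0 →
      ∃ i, MvPolynomial.eval (Sum.elim a b) (p i : Ring4 k) ≠ 0) (P : P1P1 k) :
    ∃ i, P ∈ basicOpen (p i) := by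
  obtain ⟨v⟩ := exists_coords P
  obtain ⟨ha, hb, _, _⟩ := v.2
  obtain ⟨i, hi⟩ := hp v.1.1 v.1.2 ha hb
  exact ⟨i, evalAt_ne_zero (p i).2 hi⟩

/-! ### The Koszul complex of sheaves -/

open Limits

instance : HasFiniteBiproducts (Sh k) := Abelian.hasFiniteBiproducts

variable (k) in
/-- The sheaf `𝒪(m, n)³`. -/
abbrev tripleBundle (m n : ℤ) : Sh k := ⨁ fun _ : Fin 3 => lineBundle k m n

variable (k) in
/-- The `i`-th projection `𝒪(m, n)³ → 𝒪(m, n)`. -/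
abbrev tripleProj (m n : ℤ) (i : Fin 3) : tripleBundle k m n ⟶ lineBundle k m n :=
  biproduct.π (fun _ : Fin 3 => lineBundle k m n) i

lemma triple_sections_ext {m n : ℤ} {U : Opens (P1P1 k)} {s t : sections (tripleBundle k m n) U}
    (h : ∀ i, sectionsMap (tripleProj k m n i) U s = sectionsMap (tripleProj k m n i) U t) :
    s = t := by
  have key : ∀ s : sections (tripleBundle k m n) U, s =
      ∑ i, sectionsMap (biproduct.ι (fun _ : Fin 3 => lineBundle k m n) i) U
        (sectionsMap (tripleProj k m n i) U s) := by
    intro s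
    have h1 := congrArg (fun φ => sectionsMap φ U s)
      (biproduct.total (f := fun _ : Fin 3 => lineBundle k m n))
    simp only [Fin.sum_univ_three] at h1 ⊢
    exact h1.symm
  rw [key s, key t]
  exact Finset.sum_congr rfl fun i _ => by rw [h i]

lemma exists_triple_section {m n : ℤ} {U : Opens (P1P1 k)}
    (g : Fin 3 → sections (lineBundle k m n) U) :
    ∃ s : sections (tripleBundle k m n) U, ∀ i, sectionsMap (tripleProj k m n i) U s = g i := by
  refine ⟨∑ i, sectionsMap (biproduct.ι (fun _ : Fin 3 => lineBundle k m n) i) U (g i),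
    fun j => ?_⟩
  rw [map_sum, Finset.sum_eq_single j, ← sectionsMap_comp, biproduct.ι_π_self, sectionsMap_id]
  · intro i _ hij
    rw [← sectionsMap_comp, biproduct.ι_π_ne _ hij, sectionsMap_zero]
  · simp

/-- The map `𝒪(m-6, n-3) → 𝒪(m-4, n-2)³` of the Koszul complex of sheaves. -/
def sheafKoszulThree (p : Fin 3 → Piece k 2 1) (m n : ℤ) :
    lineBundle k (m - 6) (n - 3) ⟶ tripleBundle k (m - 4) (n - 2) :=
  biproduct.lift ![mulBundle (p 2) (by ring) (by ring), -mulBundle (p 1) (by ring) (by ring),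
    mulBundle (p 0) (by ring) (by ring)]

/-- The map `𝒪(m-4, n-2)³ → 𝒪(m-2, n-1)³` of the Koszul complex of sheaves. -/
def sheafKoszulTwo (p : Fin 3 → Piece k 2 1) (m n : ℤ) :
    tripleBundle k (m - 4) (n - 2) ⟶ tripleBundle k (m - 2) (n - 1) :=
  let μ (i : Fin 3) : lineBundle k (m - 4) (n - 2) ⟶ lineBundle k (m - 2) (n - 1) :=
    mulBundle (p i) (by ring) (by ring)
  let π (i : Fin 3) := tripleProj k (m - 4) (n - 2) i
  biproduct.lift ![π 0 ≫ μ 1 + π 1 ≫ μ 2, -(π 0 ≫ μ 0) + π 2 ≫ μ 2, -(π 1 ≫ μ 0) - π 2 ≫ μ 1]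

/-- The map `𝒪(m-2, n-1)³ → 𝒪(m, n)` of the Koszul complex of sheaves. -/
def sheafKoszulOne (p : Fin 3 → Piece k 2 1) (m n : ℤ) :
    tripleBundle k (m - 2) (n - 1) ⟶ lineBundle k m n :=
  let μ (i : Fin 3) : lineBundle k (m - 2) (n - 1) ⟶ lineBundle k m n :=
    mulBundle (p i) (by ring) (by ring)
  let π (i : Fin 3) := tripleProj k (m - 2) (n - 1) i
  π 0 ≫ μ 0 + π 1 ≫ μ 1 + π 2 ≫ μ 2

/-- The value of a section of a line bundle in given coordinates of a point. -/
def value {m n : ℤ} {U : Opens (P1P1 k)} (s : sections (lineBundle k m n) U) (P : U)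
    (v : Coords P.1) : k :=
  (show sectionModule k m n U from s).1 P v

lemma value_ext {m n : ℤ} {U : Opens (P1P1 k)} {s t : sections (lineBundle k m n) U}
    (h : ∀ P v, value s P v = value t P v) : s = t :=
  Subtype.ext (funext fun P => funext fun v => h P v)

@[simp] lemma value_zero {m n : ℤ} {U : Opens (P1P1 k)} (P : U) (v : Coords P.1) :
    value (0 : sections (lineBundle k m n) U) P v = 0 := rfl

@[simp] lemma value_neg {m n : ℤ} {U : Opens (P1P1 k)} (s : sections (lineBundle k m n) U)
    (P : U) (v : Coords P.1) : value (-s) P v = -value s P v := rfl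

@[simp] lemma value_mulBundle {a b c d a' b' : ℤ} (p : Piece k a b) (ha : a + c = a')
    (hb : b + d = b') {U : Opens (P1P1 k)} (s : sections (lineBundle k c d) U) (P : U)
    (v : Coords P.1) :
    value (sectionsMap (mulBundle p ha hb) U s) P v = evalAt v.1 p.1 * value s P v := rfl

section

variable (p : Fin 3 → Piece k 2 1) {m n : ℤ} {U : Opens (P1P1 k)}

lemma value_sheafKoszulThree (f : sections (lineBundle k (m - 6) (n - 3)) U) (P : U)
    (v : Coords P.1) (i : Fin 3) :
    value (sectionsMap (tripleProj k _ _ i) U (sectionsMap (sheafKoszulThree p m n) U f)) P v =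
      ![evalAt v.1 (p 2).1 * value f P v, -(evalAt v.1 (p 1).1 * value f P v),
        evalAt v.1 (p 0).1 * value f P v] i := by
  rw [← sectionsMap_comp, sheafKoszulThree, biproduct.lift_π]
  fin_cases i <;> rfl

lemma value_sheafKoszulTwo (g : sections (tripleBundle k (m - 4) (n - 2)) U) (P : U)
    (v : Coords P.1) (i : Fin 3) :
    let x (j : Fin 3) := value (sectionsMap (tripleProj k _ _ j) U g) P v
    value (sectionsMap (tripleProj k _ _ i) U (sectionsMap (sheafKoszulTwo p m n) U g)) P v =
      ![evalAt v.1 (p 1).1 * x 0 + evalAt v.1 (p 2).1 * x 1,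
        -(evalAt v.1 (p 0).1 * x 0) + evalAt v.1 (p 2).1 * x 2,
        -(evalAt v.1 (p 0).1 * x 1) - evalAt v.1 (p 1).1 * x 2] i := by
  intro x
  rw [← sectionsMap_comp, sheafKoszulTwo, biproduct.lift_π]
  fin_cases i <;> rfl

lemma value_sheafKoszulOne (h : sections (tripleBundle k (m - 2) (n - 1)) U) (P : U)
    (v : Coords P.1) :
    let x (j : Fin 3) := value (sectionsMap (tripleProj k _ _ j) U h) P v
    value (sectionsMap (sheafKoszulOne p m n) U h) P v =
      evalAt v.1 (p 0).1 * x 0 + evalAt v.1 (p 1).1 * x 1 + evalAt v.1 (p 2).1 * x 2 := rfl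

end

lemma hom_ext_of_sectionsMap {F G : Sh k} {φ ψ : F ⟶ G}
    (h : ∀ U s, sectionsMap φ U s = sectionsMap ψ U s) : φ = ψ := by
  apply Sheaf.hom_ext
  ext U s
  exact h U.unop s

section

variable (p : Fin 3 → Piece k 2 1) (m n : ℤ)

lemma sheafKoszulThree_comp : sheafKoszulThree p m n ≫ sheafKoszulTwo p m n = 0 := by
  refine hom_ext_of_sectionsMap fun U f => triple_sections_ext fun i => value_ext fun P v => ?_
  rw [sectionsMap_comp, value_sheafKoszulTwo, sectionsMap_zero, map_zero, value_zero]
  simp only [value_sheafKoszulThree]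
  fin_cases i <;> simp <;> ring

lemma sheafKoszulTwo_comp : sheafKoszulTwo p m n ≫ sheafKoszulOne p m n = 0 := by
  refine hom_ext_of_sectionsMap fun U f => value_ext fun P v => ?_
  rw [sectionsMap_comp, value_sheafKoszulOne, sectionsMap_zero, value_zero]
  simp only [value_sheafKoszulTwo]
  simp
  ring

variable {p}
variable (hp : ∀ P : P1P1 k, ∃ i, P ∈ basicOpen (p i))
include hp

lemma mono_sheafKoszulThree : Mono (sheafKoszulThree p m n) := by
  refine mono_of_sectionsMap_injective _ fun U => ?_
  rw [injective_iff_map_eq_zero]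
  intro f hf
  refine value_ext fun P v => ?_
  have h (i) := value_sheafKoszulThree p f P v i
  simp only [hf, map_zero, value_zero] at h ⊢
  obtain ⟨i, hi⟩ := hp P.1
  have hi := hi v
  fin_cases i
  · exact (mul_eq_zero.mp (h 2).symm).resolve_left hi
  · exact (mul_eq_zero.mp (neg_eq_zero.mp (h 1).symm)).resolve_left hi
  · exact (mul_eq_zero.mp (h 0).symm).resolve_left hi

/-- Where `p₀ ≠ 0`, a triple `g` killed by the second map is the image of `g₂ / p₀`, and similarly
where `p₁ ≠ 0` or `p₂ ≠ 0`. -/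
lemma exact_sheafKoszulThree_sheafKoszulTwo :
    (ShortComplex.mk _ _ (sheafKoszulThree_comp p m n)).Exact := by
  refine exact_of_locally_exact _ fun U g hg P hP => ?_
  obtain ⟨i, hi⟩ := hp P
  let V : Opens (P1P1 k) := U ⊓ basicOpen (p i)
  let r : V ⟶ U := Opens.infLELeft _ _
  have hV : V ≤ basicOpen (p i) := inf_le_right
  refine ⟨V, r, ⟨hP, hi⟩, ?_⟩
  replace hg : sectionsMap (sheafKoszulTwo p m n) V (restrict _ r g) = 0 := by
    rw [sectionsMap_restrict]
    exact (congrArg _ hg).trans (map_zero _)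
  change ∃ t, sectionsMap (sheafKoszulThree p m n) V t = restrict _ r g
  generalize restrict (tripleBundle k (m - 4) (n - 2)) r g = g at hg
  have e (P v i) := value_sheafKoszulTwo p g P v i
  simp only [hg, map_zero, value_zero] at e
  obtain ⟨f, hf⟩ := exists_mulBundle_eq (p i) (c := m - 6) (d := n - 3) (by ring) (by ring) hV
    (![sectionsMap (tripleProj k _ _ 2) V g, -sectionsMap (tripleProj k _ _ 1) V g,
      sectionsMap (tripleProj k _ _ 0) V g] i)
  refine ⟨f, triple_sections_ext fun j => value_ext fun P v => ?_⟩
  rw [value_sheafKoszulThree]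
  have hf := congrArg (fun s => value s P v) hf
  have e0 := e P v 0
  have e1 := e P v 1
  have e2 := e P v 2
  have hi := hV P.2 v
  simp at hf e0 e1 e2
  apply mul_left_cancel₀ hi
  fin_cases i <;> fin_cases j <;> simp [-mul_eq_mul_left_iff] at hf ⊢
  · linear_combination evalAt v.1 (p 2).1 * hf - e1
  · linear_combination -evalAt v.1 (p 1).1 * hf - e2
  · linear_combination evalAt v.1 (p 0).1 * hf
  · linear_combination evalAt v.1 (p 2).1 * hf + e0
  · linear_combination -evalAt v.1 (p 1).1 * hf
  · linear_combination evalAt v.1 (p 0).1 * hf - e2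
  · linear_combination evalAt v.1 (p 2).1 * hf
  · linear_combination -evalAt v.1 (p 1).1 * hf + e0
  · linear_combination evalAt v.1 (p 0).1 * hf + e1

/-- Where `p₀ ≠ 0`, a syzygy `h` is the image of `(-h₁ / p₀, -h₂ / p₀, 0)`, and similarly
where `p₁ ≠ 0` or `p₂ ≠ 0`. -/
lemma exact_sheafKoszulTwo_sheafKoszulOne :
    (ShortComplex.mk _ _ (sheafKoszulTwo_comp p m n)).Exact := by
  refine exact_of_locally_exact _ fun U h hh P hP => ?_
  obtain ⟨i, hi⟩ := hp P
  let V : Opens (P1P1 k) := U ⊓ basicOpen (p i)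
  let r : V ⟶ U := Opens.infLELeft _ _
  have hV : V ≤ basicOpen (p i) := inf_le_right
  refine ⟨V, r, ⟨hP, hi⟩, ?_⟩
  replace hh : sectionsMap (sheafKoszulOne p m n) V (restrict _ r h) = 0 := by
    rw [sectionsMap_restrict]
    exact (congrArg _ hh).trans (map_zero _)
  change ∃ t, sectionsMap (sheafKoszulTwo p m n) V t = restrict _ r h
  generalize restrict (tripleBundle k (m - 2) (n - 1)) r h = h at hh
  have e (P v) := value_sheafKoszulOne p h P v
  simp only [hh, value_zero] at e
  let x (j : Fin 3) := sectionsMap (tripleProj k _ _ j) V h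
  have hdiv (j : Fin 3) := exists_mulBundle_eq (p i) (c := m - 4) (d := n - 2) (by ring) (by ring)
    hV (![![-x 1, -x 2, 0], ![x 0, 0, -x 2], ![0, x 0, x 1]] i j)
  choose g' hg' using hdiv
  obtain ⟨g, hg⟩ := exists_triple_section g'
  refine ⟨g, triple_sections_ext fun j => value_ext fun P v => ?_⟩
  rw [value_sheafKoszulTwo]
  simp only [hg]
  have e := e P v
  have hg0 := congrArg (fun s => value s P v) (hg' 0)
  have hg1 := congrArg (fun s => value s P v) (hg' 1)
  have hg2 := congrArg (fun s => value s P v) (hg' 2)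
  have hi := hV P.2 v
  apply mul_left_cancel₀ hi
  fin_cases i <;> fin_cases j <;> simp [-mul_eq_mul_left_iff, -mul_eq_zero, x] at hg0 hg1 hg2 e ⊢
  · linear_combination evalAt v.1 (p 1).1 * hg0 + evalAt v.1 (p 2).1 * hg1 + e
  · linear_combination -evalAt v.1 (p 0).1 * hg0 + evalAt v.1 (p 2).1 * hg2
  · linear_combination -evalAt v.1 (p 0).1 * hg1 - evalAt v.1 (p 1).1 * hg2
  · linear_combination evalAt v.1 (p 1).1 * hg0 + evalAt v.1 (p 2).1 * hg1
  · linear_combination -evalAt v.1 (p 0).1 * hg0 + evalAt v.1 (p 2).1 * hg2 + e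
  · linear_combination -evalAt v.1 (p 0).1 * hg1 - evalAt v.1 (p 1).1 * hg2
  · linear_combination evalAt v.1 (p 1).1 * hg0 + evalAt v.1 (p 2).1 * hg1
  · linear_combination -evalAt v.1 (p 0).1 * hg0 + evalAt v.1 (p 2).1 * hg2
  · linear_combination -evalAt v.1 (p 0).1 * hg1 - evalAt v.1 (p 1).1 * hg2 + e

end

/-! ### The connecting map of an exact sequence of four terms -/

section

universe v w w'

variable {R : Type w'} [CommRing R] {𝒞 : Type w} [Category.{v} 𝒞] [Abelian 𝒞] [Linear R 𝒞]
  [HasExt.{u} 𝒞]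

open Abelian

/-- If `0 → A → B → C → D` is exact and `K = ker (C → D)`, then the long exact sequence of
`0 → A → B → K → 0` gives an exact sequence
`Hom(X, B) → ker (Hom(X, C) → Hom(X, D)) → Ext¹(X, A) → Ext¹(X, B)`. -/
lemma exists_connecting (X : 𝒞) {A B C D : 𝒞} (a : A ⟶ B) (b : B ⟶ C) (c : C ⟶ D)
    (hab : a ≫ b = 0) (hbc : b ≫ c = 0) [Mono a] (exB : (ShortComplex.mk a b hab).Exact)
    (exC : (ShortComplex.mk b c hbc).Exact) :
    ∃ δ : LinearMap.ker (Linear.rightComp R X c) →ₗ[R] Ext X A 1,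
      (∀ φ, δ φ = 0 ↔ ∃ ψ : X ⟶ B, ψ ≫ b = φ.1) ∧
      ∀ e : Ext X A 1, e.comp (Ext.mk₀ a) (add_zero 1) = 0 ↔ ∃ φ, δ φ = e := by
  have hab' : a ≫ kernel.lift c b hbc = 0 := by
    rw [← cancel_mono (kernel.ι c), Category.assoc, kernel.lift_ι, hab, zero_comp]
  let S := ShortComplex.mk a (kernel.lift c b hbc) hab'
  have hS : S.ShortExact :=
    { exact := by
        let f : S ⟶ ShortComplex.mk a b hab :=
          { τ₁ := 𝟙 _, τ₂ := 𝟙 _, τ₃ := kernel.ι c }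
        have : Epi f.τ₁ := inferInstanceAs (Epi (𝟙 _))
        have : IsIso f.τ₂ := inferInstanceAs (IsIso (𝟙 _))
        have : Mono f.τ₃ := inferInstanceAs (Mono (kernel.ι c))
        exact (ShortComplex.exact_iff_of_epi_of_isIso_of_mono f).mpr exB
      mono_f := inferInstanceAs (Mono a)
      epi_g := (ShortComplex.exact_iff_epi_kernel_lift _).mp exC }
  have hl (φ : LinearMap.ker (Linear.rightComp R X c)) : φ.1 ≫ c = 0 := φ.2
  refine ⟨{ toFun := fun φ =>
              (Ext.mk₀ (kernel.lift c φ.1 (hl φ))).comp hS.extClass (zero_add 1)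
            map_add' := fun φ ψ => ?_
            map_smul' := fun r φ => ?_ }, fun φ => ⟨fun h => ?_, ?_⟩, fun e => ⟨fun h => ?_, ?_⟩⟩
  · rw [← Ext.add_comp, ← Ext.mk₀_add]
    congr 2
    rw [← cancel_mono (kernel.ι c)]
    simp
  · rw [RingHom.id_apply, ← Ext.smul_comp, ← Ext.mk₀_smul]
    congr 2
    rw [← cancel_mono (kernel.ι c)]
    simp
  · obtain ⟨x, hx⟩ := Ext.covariant_sequence_exact₃ X hS _ (zero_add 1) h
    obtain ⟨ψ, rfl⟩ := (Ext.mk₀_bijective _ _).surjective x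
    rw [Ext.mk₀_comp_mk₀] at hx
    have := (Ext.mk₀_bijective _ _).injective hx
    refine ⟨ψ, ?_⟩
    rw [← kernel.lift_ι c φ.1 (hl φ), ← this, Category.assoc]
    exact congrArg (ψ ≫ ·) (kernel.lift_ι c b hbc).symm
  · rintro ⟨ψ, hψ⟩
    have : kernel.lift c φ.1 (hl φ) = ψ ≫ S.g := by
      rw [← cancel_mono (kernel.ι c), kernel.lift_ι, Category.assoc, ← hψ]
      exact congrArg (ψ ≫ ·) (kernel.lift_ι c b hbc).symm
    change (Ext.mk₀ (kernel.lift c φ.1 (hl φ))).comp hS.extClass (zero_add 1) = 0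
    rw [this, ← Ext.mk₀_comp_mk₀, Ext.comp_assoc_of_second_deg_zero, hS.comp_extClass,
      Ext.comp_zero]
  · obtain ⟨x, hx⟩ := Ext.covariant_sequence_exact₁ X hS e h (zero_add 1)
    obtain ⟨ψ, rfl⟩ := (Ext.mk₀_bijective _ _).surjective x
    have hψ : ψ ≫ kernel.ι c ≫ c = 0 := by rw [kernel.condition, comp_zero]
    refine ⟨⟨ψ ≫ kernel.ι c, ?_⟩, ?_⟩
    · rw [LinearMap.mem_ker]
      exact (Category.assoc _ _ _).trans hψ
    · rw [← hx]
      change (Ext.mk₀ (kernel.lift c (ψ ≫ kernel.ι c) _)).comp hS.extClass (zero_add 1) = _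
      congr 2
      rw [← cancel_mono (kernel.ι c), kernel.lift_ι]
  · rintro ⟨φ, rfl⟩
    change ((Ext.mk₀ (kernel.lift c φ.1 (hl φ))).comp hS.extClass (zero_add 1)).comp
      (Ext.mk₀ S.f) (add_zero 1) = 0
    rw [Ext.comp_assoc_of_third_deg_zero, hS.extClass_comp, Ext.comp_zero]

end

/-! ### Cohomology of the Koszul complex -/

/-- The kernel of `d₁` is the kernel of `H¹(m-6, n-3) → H¹(𝒪(m-4, n-2)³)`. -/
lemma mem_E₂_iff (p : Fin 3 → Piece k 2 1) (m n : ℤ)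
    (e : H k 1 (m - 6) (n - 3)) :
    e ∈ E₂ p m n ↔
      Abelian.Ext.comp e (Abelian.Ext.mk₀ (sheafKoszulThree p m n)) (add_zero 1) = 0 := by
  have h (i : Fin 3) : d₁ p m n e i =
      (Abelian.Ext.comp e (Abelian.Ext.mk₀ (sheafKoszulThree p m n)) (add_zero 1)).comp
        (Abelian.Ext.mk₀ (tripleProj k _ _ i)) (add_zero 1) := by
    rw [Abelian.Ext.comp_assoc_of_third_deg_zero, Abelian.Ext.mk₀_comp_mk₀, sheafKoszulThree,
      biproduct.lift_π]
    fin_cases i <;> rfl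
  rw [← (Abelian.Ext.addEquivBiproduct (constSheaf k)
    (biproduct.isBilimit fun _ : Fin 3 => lineBundle k (m - 4) (n - 2)) 1).map_eq_zero_iff,
    LinearMap.mem_ker]
  exact Eq.congr (funext h) rfl

variable [IsAlgClosed k]

/-- `Hom(k, 𝒪(m, n)³) = R_{m,n}³`. -/
def homEquivTriple (m n : ℤ) :
    (constSheaf k ⟶ tripleBundle k m n) ≃ₗ[k] (Fin 3 → Piece k m n) where
  toFun φ i := homEquivPiece m n (φ ≫ tripleProj k m n i)
  map_add' φ ψ := by funext i; simp
  map_smul' r φ := by funext i; simp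
  invFun g := biproduct.lift fun i => (homEquivPiece m n).symm (g i)
  left_inv φ := by
    refine biproduct.hom_ext _ _ fun i => ?_
    simp
  right_inv g := by funext i; simp

section

variable (p : Fin 3 → Piece k 2 1) (m n : ℤ)

lemma homEquivTriple_comp_koszulThree (φ : constSheaf k ⟶ lineBundle k (m - 6) (n - 3)) :
    homEquivTriple _ _ (φ ≫ sheafKoszulThree p m n) = koszulThree p m n (homEquivPiece _ _ φ) := by
  funext i
  change homEquivPiece _ _ ((φ ≫ sheafKoszulThree p m n) ≫ tripleProj k _ _ i) = _
  rw [Category.assoc, sheafKoszulThree, biproduct.lift_π]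
  fin_cases i
  · exact homEquivPiece_mul _ (by ring) (by ring) φ
  · change homEquivPiece _ _ (φ ≫ (-mulBundle (p 1) (by ring) (by ring))) = _
    rw [Preadditive.comp_neg, map_neg, homEquivPiece_mul]
    rfl
  · exact homEquivPiece_mul _ (by ring) (by ring) φ

lemma homEquivTriple_comp_koszulTwo (φ : constSheaf k ⟶ tripleBundle k (m - 4) (n - 2)) :
    homEquivTriple _ _ (φ ≫ sheafKoszulTwo p m n) =
      koszulTwoAux p m n (homEquivTriple _ _ φ) := by
  funext i
  change homEquivPiece _ _ ((φ ≫ sheafKoszulTwo p m n) ≫ tripleProj k _ _ i) = _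
  have h (i j) : homEquivPiece (m - 2) (n - 1) (φ ≫ tripleProj k (m - 4) (n - 2) j ≫
      mulBundle (p i) (by ring) (by ring)) =
        mulPiece (p i) (by ring) (by ring) (homEquivTriple _ _ φ j) := by
    rw [← Category.assoc, homEquivPiece_mul]
    rfl
  rw [Category.assoc, sheafKoszulTwo, biproduct.lift_π]
  fin_cases i
  · change homEquivPiece _ _ (φ ≫ (tripleProj k _ _ 0 ≫ mulBundle (p 1) _ _ +
      tripleProj k _ _ 1 ≫ mulBundle (p 2) _ _)) = _
    rw [Preadditive.comp_add, map_add, h, h]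
    rfl
  · change homEquivPiece _ _ (φ ≫ (-(tripleProj k _ _ 0 ≫ mulBundle (p 0) _ _) +
      tripleProj k _ _ 2 ≫ mulBundle (p 2) _ _)) = _
    rw [Preadditive.comp_add, Preadditive.comp_neg, map_add, map_neg, h, h]
    rfl
  · change homEquivPiece _ _ (φ ≫ (-(tripleProj k _ _ 1 ≫ mulBundle (p 0) _ _) -
      tripleProj k _ _ 2 ≫ mulBundle (p 1) _ _)) = _
    rw [Preadditive.comp_sub, Preadditive.comp_neg, map_sub, map_neg, h, h]
    rfl

lemma homEquivTriple_mem_syz_iff (φ : constSheaf k ⟶ tripleBundle k (m - 2) (n - 1)) :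
    homEquivTriple _ _ φ ∈ Syz p m n ↔ φ ≫ sheafKoszulOne p m n = 0 := by
  have h (i) : homEquivPiece m n (φ ≫ tripleProj k (m - 2) (n - 1) i ≫
      mulBundle (p i) (by ring) (by ring)) =
        mulPiece (p i) (by ring) (by ring) (homEquivTriple _ _ φ i) := by
    rw [← Category.assoc, homEquivPiece_mul]
    rfl
  rw [← (homEquivPiece m n).map_eq_zero_iff, sheafKoszulOne, Preadditive.comp_add,
    Preadditive.comp_add, map_add, map_add, h, h, h, mem_syz_iff, Fin.sum_univ_three,
    ← Submodule.coe_eq_zero]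
  rfl

/-- `Hom(k, ker (𝒪(m-2, n-1)³ → 𝒪(m, n))) = Syz(p)_{m,n}`. -/
def kerEquivSyz : LinearMap.ker (Linear.rightComp k (constSheaf k) (sheafKoszulOne p m n)) ≃ₗ[k]
    Syz p m n :=
  (homEquivTriple (m - 2) (n - 1)).ofSubmodules _ _ <| by
    ext A
    obtain ⟨φ, rfl⟩ := (homEquivTriple (m - 2) (n - 1)).surjective A
    rw [homEquivTriple_mem_syz_iff, Submodule.mem_map_equiv, LinearEquiv.symm_apply_apply]
    rfl

end

end

end BigradedKoszul

open BigradedKoszul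

theorem lemma2p1 {k : Type u} [Field k] [IsAlgClosed k]
    (p : Fin 3 → BigradedKoszul.Piece k 2 1)
    (hp : ∀ a b : Fin 2 → k, a ≠ 0 → b ≠ 0 →
      ∃ i, MvPolynomial.eval (Sum.elim a b) (p i : BigradedKoszul.Ring4 k) ≠ 0)
    (m n : ℤ) :
    ∃ ε : BigradedKoszul.Syz p m n →ₗ[k] BigradedKoszul.E₂ p m n,
      Function.Injective (BigradedKoszul.koszulThree p m n) ∧
      Function.Exact (BigradedKoszul.koszulThree p m n) (BigradedKoszul.koszulTwo p m n) ∧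
      Function.Exact (BigradedKoszul.koszulTwo p m n) ε ∧
      Function.Surjective ε := by
  have hp' : ∀ P : P1P1 k, ∃ i, P ∈ basicOpen (p i) := exists_mem_basicOpen hp
  have := mono_sheafKoszulThree m n hp'
  have exB := exact_sheafKoszulThree_sheafKoszulTwo m n hp'
  obtain ⟨δ, hδ, hE⟩ := exists_connecting (R := k) (constSheaf k) (sheafKoszulThree p m n)
    (sheafKoszulTwo p m n) (sheafKoszulOne p m n) (sheafKoszulThree_comp p m n)
    (sheafKoszulTwo_comp p m n) exB (exact_sheafKoszulTwo_sheafKoszulOne m n hp')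
  let ε : Syz p m n →ₗ[k] E₂ p m n :=
    (δ.codRestrict (E₂ p m n) fun φ => (mem_E₂_iff p m n _).mpr ((hE _).mpr ⟨φ, rfl⟩)) ∘ₗ
      (kerEquivSyz p m n).symm.toLinearMap
  refine ⟨ε, ?_, fun g => ?_, fun A => ?_, fun e => ?_⟩
  · rw [injective_iff_map_eq_zero]
    intro f hf
    obtain ⟨φ, rfl⟩ := (homEquivPiece _ _).surjective f
    rw [← homEquivTriple_comp_koszulThree, LinearEquiv.map_eq_zero_iff] at hf
    rw [LinearEquiv.map_eq_zero_iff, ← cancel_mono (sheafKoszulThree p m n), hf,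
      Limits.zero_comp]
  · obtain ⟨φ, rfl⟩ := (homEquivTriple _ _).surjective g
    rw [← Submodule.coe_eq_zero]
    change koszulTwoAux p m n _ = 0 ↔ _
    rw [← homEquivTriple_comp_koszulTwo, LinearEquiv.map_eq_zero_iff]
    constructor
    · intro h
      refine ⟨homEquivPiece _ _ (exB.lift φ h), ?_⟩
      rw [← homEquivTriple_comp_koszulThree]
      exact congrArg _ (exB.lift_f φ h)
    · rintro ⟨f, hf⟩
      obtain ⟨ψ, rfl⟩ := (homEquivPiece _ _).surjective f
      rw [← homEquivTriple_comp_koszulThree] at hf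
      rw [← (homEquivTriple _ _).injective hf, Category.assoc, sheafKoszulThree_comp,
        Limits.comp_zero]
  · obtain ⟨φ, rfl⟩ := (kerEquivSyz p m n).surjective A
    have h1 : ε (kerEquivSyz p m n φ) = 0 ↔ δ φ = 0 := by
      rw [← Submodule.coe_eq_zero]
      simp [ε]
    rw [h1, hδ]
    constructor
    · rintro ⟨ψ, hψ⟩
      refine ⟨homEquivTriple _ _ ψ, Subtype.ext ?_⟩
      change koszulTwoAux p m n _ = homEquivTriple _ _ φ.1
      rw [← hψ, homEquivTriple_comp_koszulTwo]
    · rintro ⟨g, hg⟩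
      obtain ⟨ψ, rfl⟩ := (homEquivTriple _ _).surjective g
      refine ⟨ψ, (homEquivTriple _ _).injective ?_⟩
      rw [homEquivTriple_comp_koszulTwo]
      exact congrArg Subtype.val hg
  · obtain ⟨φ, hφ⟩ := (hE e.1).mp ((mem_E₂_iff p m n _).mp e.2)
    refine ⟨kerEquivSyz p m n φ, Subtype.ext ?_⟩
    simp [ε, hφ]
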